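/- Let $(R,\mathfrak n)$ be a regular local ring of dimension two with infinite residue field, and let $I$ be an ideal of $R$ such that $A=R/I$ is an Artinian Gorenstein local ring, with maximal ideal $\mathfrak m=\mathfrak n/I$. Let $h_j=\dim_{A/\mathfrak m}\,\mathfrak m^j/\mathfrak m^{j+1}$ ($j\ge 0$) be the Hilbert function of $A$, which has the form $(1,2,\dots,d,h_d,\dots,h_s,0,0,\dots)$ with $d=h_{d-1}\ge h_d\ge\dots\ge h_s\ge 1$. Then $$e_j:=|h_j-h_{j-1}|\le 1\qquad\text{for every } j>0 .$$ -/

import Mathlib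

open IsLocalRing

/-- A commutative ring `A` is a Gorenstein local ring if it is a Noetherian local ring which has
finite injective dimension as a module over itself. -/
class IsGorensteinLocalRing (A : Type*) [CommRing A] : Prop extends
    IsLocalRing A, IsNoetherianRing A where
  exists_hasInjectiveDimensionLE :
    ∃ n : ℕ, CategoryTheory.HasInjectiveDimensionLE (ModuleCat.of A A) n

/-- The Hilbert function of a local ring `(A, 𝔪)`, i.e. that of its associated graded ring
`⨁ j, 𝔪 ^ j / 𝔪 ^ (j + 1)`: its value at `j` is the dimension of `𝔪 ^ j / 𝔪 • 𝔪 ^ j` as a vector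
space over the residue field `A / 𝔪`. -/
noncomputable def localHilbertFunction (A : Type*) [CommRing A] [IsLocalRing A] (j : ℕ) : ℕ :=
  Module.finrank (A ⧸ maximalIdeal A)
    (↥(maximalIdeal A ^ j) ⧸
      (maximalIdeal A • (⊤ : Submodule A ↥(maximalIdeal A ^ j))))

/-! ### Gorenstein Artinian rings: self-injectivity and simple socle. -/

section InjectiveDimension

open CategoryTheory Abelian

universe u

variable {A : Type u} [CommRing A]

/-! Two facts about A matter: 𝔪 = (x, y), inherited from R, and the socle is simple, because A is
self-injective. Compare degrees j and j + 1. If the initial forms of x, y satisfy no relation of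
degree ≤ j + 1, then x is injective from 𝔪^j/𝔪^(j+1) to 𝔪^(j+1)/𝔪^(j+2), with cokernel spanned by
y^(j+1): h grows by 0 or 1 (`localHilbertFunction_of_mul_mem_pow`). Otherwise, the residue field
being infinite, a change of coordinates gives z with 𝔪^(j+1) = z𝔪^j
(`HasFormRelation.exists_pow_succ_eq`). Then h_j and h_{j+1} are the lengths of ann(z) ∩ 𝔪^j and
ann(z) ∩ 𝔪^(j+1). Multiplication by y maps the first into the second with kernel in the socle: h
drops by 0 or 1 (`localHilbertFunction_of_pow_succ_eq`). -/

/-- Three-term exactness of the contravariant `Ext` sequence, in terms of modules. -/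
lemma subsingleton_ext_of_exact {M₁ M₂ M₃ : Type u} [AddCommGroup M₁] [Module A M₁]
    [AddCommGroup M₂] [Module A M₂] [AddCommGroup M₃] [Module A M₃] (f : M₁ →ₗ[A] M₂)
    (g : M₂ →ₗ[A] M₃) (hf : Function.Injective f) (hg : Function.Surjective g)
    (hfg : Function.Exact f g) (X : ModuleCat.{u} A) (n : ℕ)
    (h₁ : Subsingleton (Ext (ModuleCat.of A M₁) X n))
    (h₃ : Subsingleton (Ext (ModuleCat.of A M₃) X n)) :
    Subsingleton (Ext (ModuleCat.of A M₂) X n) := by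
  have hS := ModuleCat.shortComplex_shortExact (ModuleCat.shortComplexOfCompEqZero f g
    hfg.linearMap_comp_eq_zero) hfg hf hg
  refine subsingleton_of_forall_eq 0 fun x ↦ ?_
  obtain ⟨y, rfl⟩ := Ext.contravariant_sequence_exact₂ hS _ x (h₁.elim _ _)
  rw [h₃.elim y 0, Ext.comp_zero]

/-- An element of `Ext` on a submodule of `M₂` lifts to `M₂` if the next `Ext` of the cokernel
vanishes. -/
lemma exists_ext_comp_eq {M₁ M₂ M₃ : Type u} [AddCommGroup M₁] [Module A M₁]
    [AddCommGroup M₂] [Module A M₂] [AddCommGroup M₃] [Module A M₃] (f : M₁ →ₗ[A] M₂)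
    (g : M₂ →ₗ[A] M₃) (hf : Function.Injective f) (hg : Function.Surjective g)
    (hfg : Function.Exact f g) (X : ModuleCat.{u} A) (n : ℕ)
    (h₃ : Subsingleton (Ext (ModuleCat.of A M₃) X (1 + n)))
    (x : Ext (ModuleCat.of A M₁) X n) :
    ∃ y : Ext (ModuleCat.of A M₂) X n,
      (Ext.mk₀ (ModuleCat.ofHom f)).comp y (zero_add n) = x := by
  have hS := ModuleCat.shortComplex_shortExact (ModuleCat.shortComplexOfCompEqZero f g
    hfg.linearMap_comp_eq_zero) hfg hf hg
  exact Ext.contravariant_sequence_exact₁ hS _ x rfl (h₃.elim _ _)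

/-- By prime filtrations only N = A/𝔪 matters. It embeds in A, 𝔪 being an associated prime, so its
Ext is squeezed between Ext of the free module A and the next Ext of the cokernel. -/
lemma subsingleton_ext_of_subsingleton_ext_succ [IsArtinianRing A] [IsLocalRing A] (n : ℕ)
    (h : ∀ (N : Type u) [AddCommGroup N] [Module A N] [Module.Finite A N],
      Subsingleton (Ext (ModuleCat.of A N) (ModuleCat.of A A) (n + 2)))
    (N : Type u) [AddCommGroup N] [Module A N] [Module.Finite A N] :
    Subsingleton (Ext (ModuleCat.of A N) (ModuleCat.of A A) (n + 1)) := by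
  induction ‹Module.Finite A N› using
    IsNoetherianRing.induction_on_isQuotientEquivQuotientPrime A with
  | subsingleton N =>
    refine subsingleton_of_forall_eq 0 fun x ↦ ?_
    have : Projective (ModuleCat.of A N) := (ModuleCat.isZero_of_subsingleton _).projective
    exact x.eq_zero_of_projective
  | quotient N p e =>
    obtain ⟨q, hq⟩ := associatedPrimes.nonempty A A
    have hqp : q = p.1 := by
      have hq' : q.IsPrime := IsAssociatedPrime.isPrime hq
      rw [eq_maximalIdeal (Ideal.IsPrime.isMaximal' hq'),
        eq_maximalIdeal (Ideal.IsPrime.isMaximal' p.2)]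
    obtain ⟨-, f, hf⟩ := (isAssociatedPrime_iff_exists_injective_linearMap q A).mp hq
    subst hqp
    refine subsingleton_of_forall_eq 0 fun x ↦ ?_
    obtain ⟨y, rfl⟩ := exists_ext_comp_eq (f ∘ₗ e.toLinearMap) (LinearMap.range _).mkQ
      (hf.comp e.injective) (Submodule.mkQ_surjective _) (LinearMap.exact_map_mkQ_range _) _ _
      (by rw [show 1 + (n + 1) = n + 2 by ring]; exact h _) x
    have : Projective (ModuleCat.of A A) :=
      ModuleCat.projective_of_free (Module.Basis.singleton Unit A)
    rw [y.eq_zero_of_projective, Ext.comp_zero]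
  | exact N₁ N₂ N₃ f g hf hg hfg h₁ h₃ =>
    exact subsingleton_ext_of_exact f g hf hg hfg _ _ h₁ h₃

lemma subsingleton_ext_one_of_hasInjectiveDimensionLE [IsArtinianRing A] [IsLocalRing A] (n : ℕ)
    (hn : HasInjectiveDimensionLE (ModuleCat.of A A) n)
    (N : Type u) [AddCommGroup N] [Module A N] [Module.Finite A N] :
    Subsingleton (Ext (ModuleCat.of A N) (ModuleCat.of A A) 1) := by
  -- Truncated subtraction: the degree descends from n + 1 and stops at 1, reached at k = n.
  have key : ∀ k : ℕ, ∀ (N : Type u) [AddCommGroup N] [Module A N] [Module.Finite A N],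
      Subsingleton (Ext (ModuleCat.of A N) (ModuleCat.of A A) (n - k + 1)) := by
    intro k
    induction k with
    | zero => exact fun N _ _ _ ↦ HasInjectiveDimensionLT.subsingleton _ (n + 1) _ le_rfl _
    | succ k ih =>
      intro N _ _ _
      rcases Nat.lt_or_ge k n with hk | hk
      · refine subsingleton_ext_of_subsingleton_ext_succ _ ?_ N
        rw [show n - (k + 1) + 2 = n - k + 1 by omega]
        exact ih
      · rw [show n - (k + 1) = n - k by omega]
        exact ih N
  simpa using key n N

/-- In an Artinian Gorenstein local ring, every nonzero ideal contains the socle. -/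
lemma IsGorensteinLocalRing.mem_span_singleton_of_socle [IsArtinianRing A]
    [IsGorensteinLocalRing A] {a b : A}
    (hb : ∀ r ∈ maximalIdeal A, r * b = 0) (ha0 : a ≠ 0) : b ∈ Ideal.span {a} := by
  obtain ⟨n, hn⟩ := IsGorensteinLocalRing.exists_hasInjectiveDimensionLE (A := A)
  have hle : LinearMap.ker (LinearMap.toSpanSingleton A A a) ≤
      LinearMap.ker (LinearMap.toSpanSingleton A A b) := by
    intro r hr
    simp only [LinearMap.mem_ker, LinearMap.toSpanSingleton_apply, smul_eq_mul] at hr ⊢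
    refine hb r ?_
    by_contra h
    rw [mem_maximalIdeal, mem_nonunits_iff, not_not] at h
    exact ha0 ((h.mul_right_eq_zero).mp hr)
  -- f embeds A/ann(a) in A as (a), and φ sends 1 to b. Extending φ along f to ψ : A → A gives b =
  -- ψ(a) = aψ(1).
  let f := (LinearMap.ker (LinearMap.toSpanSingleton A A a)).liftQ _ le_rfl
  have hf : Function.Injective f :=
    LinearMap.ker_eq_bot.mp (Submodule.ker_liftQ_eq_bot _ _ _ le_rfl)
  let φ := (LinearMap.ker (LinearMap.toSpanSingleton A A a)).liftQ _ hle
  obtain ⟨y, hy⟩ := exists_ext_comp_eq f (LinearMap.range f).mkQ hf (Submodule.mkQ_surjective _)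
    (LinearMap.exact_map_mkQ_range _) (ModuleCat.of A A) 0
    (subsingleton_ext_one_of_hasInjectiveDimensionLE n hn _) (Ext.mk₀ (ModuleCat.ofHom φ))
  obtain ⟨ψ, rfl⟩ := Ext.homEquiv₀.symm.surjective y
  rw [Ext.homEquiv₀_symm_apply, Ext.mk₀_comp_mk₀] at hy
  have hy' := Ext.homEquiv₀.symm.injective hy
  have hfa : f (Submodule.Quotient.mk 1) = a := one_smul A a
  have hφb : φ (Submodule.Quotient.mk 1) = b := one_smul A b
  have hψ : ψ.hom (f (Submodule.Quotient.mk 1)) = φ (Submodule.Quotient.mk 1) :=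
    congr($(hy').hom (Submodule.Quotient.mk 1))
  rw [hfa, hφb] at hψ
  rw [Ideal.mem_span_singleton']
  refine ⟨ψ.hom 1, ?_⟩
  have := ψ.hom.map_smul a 1
  simp only [smul_eq_mul, mul_one] at this
  rw [mul_comm, ← hψ]
  exact this.symm

end InjectiveDimension

/-! ### Lengths of submodules and the Hilbert function. -/

section Length

variable {A : Type*} [CommRing A]

lemma Module.length_eq_inf_ker_add_map {M N : Type*} [AddCommGroup M] [Module A M]
    [AddCommGroup N] [Module A N] (φ : M →ₗ[A] N) (P : Submodule A M) :
    Module.length A P =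
      Module.length A ↥(P ⊓ LinearMap.ker φ) + Module.length A ↥(P.map φ) := by
  refine Module.length_eq_add_of_exact (Submodule.inclusion inf_le_left)
    (φ.submoduleMap P) (Submodule.inclusion_injective _) (φ.submoduleMap_surjective P) ?_
  intro x
  constructor
  · intro hx
    have hx' : φ x = 0 := congr_arg Subtype.val hx
    exact ⟨⟨x, x.2, hx'⟩, rfl⟩
  · rintro ⟨y, rfl⟩
    exact Subtype.ext y.2.2

lemma Module.length_submodule_le {M : Type*} [AddCommGroup M] [Module A M] {P Q : Submodule A M}
    (h : P ≤ Q) : Module.length A P ≤ Module.length A Q :=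
  Module.length_le_of_injective (Submodule.inclusion h) (Submodule.inclusion_injective h)

lemma Module.length_span_singleton_le_one [IsLocalRing A] {M : Type*} [AddCommGroup M]
    [Module A M] (z : M) (hz : ∀ r ∈ maximalIdeal A, r • z = 0) :
    Module.length A ↥(Submodule.span A {z}) ≤ 1 := by
  have hle : maximalIdeal A ≤ LinearMap.ker (LinearMap.toSpanSingleton A M z) := fun r hr ↦ by
    simpa using hz r hr
  have hsimple : IsSimpleModule A (A ⧸ maximalIdeal A) :=
    isSimpleModule_iff_isCoatom.mpr (maximalIdeal.isMaximal A).out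
  rw [← Module.length_eq_one A (A ⧸ maximalIdeal A), LinearMap.span_singleton_eq_range]
  have hr : LinearMap.range (LinearMap.toSpanSingleton A M z) =
      LinearMap.range ((maximalIdeal A).liftQ (LinearMap.toSpanSingleton A M z) hle) :=
    (Submodule.range_liftQ _ _ _).symm
  rw [hr]
  exact Module.length_le_of_surjective (LinearMap.rangeRestrict _)
    (LinearMap.surjective_rangeRestrict _)

lemma Module.length_le_add_one_of_le_sup_span [IsLocalRing A] {M : Type*} [AddCommGroup M]
    [Module A M] {P Q : Submodule A M} (z : M) (hz : ∀ r ∈ maximalIdeal A, r • z ∈ P)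
    (hQ : Q ≤ P ⊔ Submodule.span A {z}) :
    Module.length A Q ≤ Module.length A P + 1 := by
  rw [Module.length_eq_inf_ker_add_map P.mkQ Q, Submodule.ker_mkQ]
  refine add_le_add (Module.length_submodule_le inf_le_right) ?_
  have hmap : Q.map P.mkQ ≤ Submodule.span A {P.mkQ z} := by
    refine (Submodule.map_mono hQ).trans ?_
    rw [Submodule.map_sup, Submodule.mkQ_map_self, bot_sup_eq, Submodule.map_span,
      Set.image_singleton]
  refine (Module.length_submodule_le hmap).trans (Module.length_span_singleton_le_one _ ?_)
  intro r hr
  rw [← map_smul, Submodule.mkQ_apply, Submodule.Quotient.mk_eq_zero]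
  exact hz r hr

lemma Module.length_le_one_of_socle [IsLocalRing A]
    (hsoc : ∀ a b : A, (∀ r ∈ maximalIdeal A, r * b = 0) → a ≠ 0 →
      b ∈ Ideal.span {a}) (N : Ideal A) (hN : ∀ r ∈ maximalIdeal A, ∀ a ∈ N, r * a = 0) :
    Module.length A N ≤ 1 := by
  by_cases h : N = ⊥
  · subst h
    rw [Module.length_bot]
    exact zero_le_one
  obtain ⟨a, haN, ha0⟩ := Submodule.exists_mem_ne_zero_of_ne_bot h
  have hle : N ≤ Submodule.span A {a} := fun b hb ↦
    hsoc a b (fun r hr ↦ hN r hr b hb) ha0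
  exact (Module.length_submodule_le hle).trans
    (Module.length_span_singleton_le_one a fun r hr ↦ hN r hr a haN)

lemma localHilbertFunction_add_length [IsLocalRing A] [IsArtinianRing A] (j : ℕ) :
    (localHilbertFunction A j : ℕ∞) + Module.length A ↥(maximalIdeal A ^ (j + 1)) =
      Module.length A ↥(maximalIdeal A ^ j) := by
  set m := maximalIdeal A
  let T : Submodule A ↥(m ^ j) := m • ⊤
  let _ : Field (A ⧸ m) := Ideal.Quotient.field m
  have h1 : (localHilbertFunction A j : ℕ∞) = Module.length A (↥(m ^ j) ⧸ T) := by
    rw [Module.length_eq_of_surjective (R := A ⧸ m) (S := A) Ideal.Quotient.mk_surjective,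
      Module.length_eq_finrank]
    rfl
  have h2 := Module.length_eq_inf_ker_add_map (m ^ j).subtype T
  rw [Submodule.ker_subtype, inf_bot_eq, Module.length_bot, zero_add, Submodule.map_smul'',
    Submodule.map_top, Submodule.range_subtype, smul_eq_mul, ← pow_succ'] at h2
  have h3 := Module.length_eq_add_of_exact T.subtype T.mkQ T.injective_subtype T.mkQ_surjective
    (LinearMap.exact_subtype_mkQ T)
  rw [h3, h1, ← h2, add_comm]

end Length

/-! ### Binary forms in two generators. -/

section HilbertFunction

variable {A : Type*} [CommRing A]

/-- The value at `(x, y)` of the binary form of degree `d` with coefficients `c`. -/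
def binaryForm (x y : A) (d : ℕ) (c : ℕ → A) : A :=
  ∑ i ∈ Finset.range (d + 1), c i * x ^ i * y ^ (d - i)

lemma mul_binaryForm (x y : A) (d : ℕ) (c : ℕ → A) :
    x * binaryForm x y d c = binaryForm x y (d + 1) (fun i ↦ if i = 0 then 0 else c (i - 1)) := by
  unfold binaryForm
  rw [Finset.sum_range_succ' _ (d + 1), Finset.mul_sum]
  simp only [Nat.add_eq_zero_iff, one_ne_zero, and_false, if_false, if_true, zero_mul, add_zero,
    Nat.add_sub_add_right, Nat.add_sub_cancel]
  exact Finset.sum_congr rfl fun i _ ↦ by ring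

lemma mul_binaryForm' (x y : A) (d : ℕ) (c : ℕ → A) :
    y * binaryForm x y d c = binaryForm x y (d + 1) (fun i ↦ if i ≤ d then c i else 0) := by
  unfold binaryForm
  rw [Finset.sum_range_succ _ (d + 1), Finset.mul_sum]
  simp only [Nat.not_succ_le_self, if_false, zero_mul, add_zero]
  refine Finset.sum_congr rfl fun i hi ↦ ?_
  have hi' : i ≤ d := by simpa [Nat.lt_succ_iff] using hi
  rw [if_pos hi', Nat.succ_sub hi', pow_succ]
  ring

lemma binaryForm_add (x y : A) (d : ℕ) (c c' : ℕ → A) :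
    binaryForm x y d c + binaryForm x y d c' = binaryForm x y d (c + c') := by
  simp [binaryForm, ← Finset.sum_add_distrib, add_mul]

lemma exists_binaryForm_eq {x y : A} (d : ℕ) {a : A} (ha : a ∈ Ideal.span {x, y} ^ d) :
    ∃ c, binaryForm x y d c = a := by
  induction d generalizing a with
  | zero => exact ⟨fun _ ↦ a, by simp [binaryForm]⟩
  | succ d ih =>
    rw [pow_succ'] at ha
    nth_rewrite 1 [Ideal.span_insert] at ha
    rw [Ideal.sup_mul, Submodule.mem_sup] at ha
    obtain ⟨u, hu, v, hv, rfl⟩ := ha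
    obtain ⟨b, hb, rfl⟩ := Ideal.mem_span_singleton_mul.mp hu
    obtain ⟨c, hc, rfl⟩ := Ideal.mem_span_singleton_mul.mp hv
    obtain ⟨f, rfl⟩ := ih hb
    obtain ⟨g, rfl⟩ := ih hc
    exact ⟨_, by rw [mul_binaryForm, mul_binaryForm', binaryForm_add]⟩

/-- Modulo x - ty, each x may be replaced by ty. -/
lemma pow_mul_pow_sub_mem {x y : A} (t : A) (d i : ℕ) (hi : i ≤ d + 1) :
    x ^ i * y ^ (d + 1 - i) - t ^ i * y ^ (d + 1) ∈
      Ideal.span {x - t * y} * Ideal.span {x, y} ^ d := by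
  induction i with
  | zero => simp
  | succ i ih =>
    have hi' : i ≤ d := by omega
    have h := ih (by omega)
    have hxy : x ^ i * y ^ (d - i) ∈ Ideal.span {x, y} ^ d := by
      obtain ⟨k, rfl⟩ := Nat.exists_eq_add_of_le hi'
      rw [Nat.add_sub_cancel_left, pow_add]
      exact Ideal.mul_mem_mul (Ideal.pow_mem_pow (Ideal.subset_span (by simp)) _)
        (Ideal.pow_mem_pow (Ideal.subset_span (by simp)) _)
    have h' := Ideal.mul_mem_mul (Ideal.mem_span_singleton_self (x - t * y)) hxy
    convert Ideal.add_mem _ h' (Ideal.mul_mem_left _ t h) using 1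
    rw [Nat.succ_sub hi', Nat.add_sub_add_right, pow_succ y (d - i)]
    ring

lemma binaryForm_sub_mem {x y : A} (t : A) (d : ℕ) (c : ℕ → A) :
    binaryForm x y (d + 1) c - (∑ i ∈ Finset.range (d + 2), c i * t ^ i) * y ^ (d + 1) ∈
      Ideal.span {x - t * y} * Ideal.span {x, y} ^ d := by
  rw [binaryForm, Finset.sum_mul, ← Finset.sum_sub_distrib]
  refine Ideal.sum_mem _ fun i hi ↦ ?_
  have hi' : i ≤ d + 1 := by simpa [Nat.lt_succ_iff] using hi
  convert Ideal.mul_mem_left _ (c i) (pow_mul_pow_sub_mem (x := x) (y := y) t d i hi') using 1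
  ring

lemma span_pair_pow_succ_le (x y : A) (d : ℕ) :
    Ideal.span {x, y} ^ (d + 1) ≤
      Ideal.span {x} * Ideal.span {x, y} ^ d ⊔ Ideal.span {y ^ (d + 1)} := by
  induction d with
  | zero => simp [Ideal.span_insert]
  | succ d ih =>
    rw [pow_succ']
    nth_rewrite 1 [Ideal.span_insert]
    rw [Ideal.sup_mul]
    refine sup_le le_sup_left ((Ideal.mul_mono_right ih).trans ?_)
    rw [Ideal.mul_sup, Ideal.span_singleton_mul_span_singleton, ← pow_succ' y (d + 1)]
    refine sup_le_sup_right ?_ _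
    rw [mul_left_comm, pow_succ']
    exact Ideal.mul_mono_right (Ideal.mul_mono_left (Ideal.span_mono (by simp)))

lemma map_mulLeft_eq (x : A) (J : Ideal A) :
    Submodule.map (LinearMap.mulLeft A x) J = Ideal.span {x} * J := by
  ext a
  simp [Ideal.mem_span_singleton_mul]

/-! ### Relations between initial forms, and the two growth bounds. -/

variable [IsLocalRing A]

lemma binaryForm_mem_pow_succ {x y : A} (hx : x ∈ maximalIdeal A) (hy : y ∈ maximalIdeal A)
    (d : ℕ) (c : ℕ → A) (hc : ∀ i ≤ d, ¬ IsUnit (c i)) :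
    binaryForm x y d c ∈ maximalIdeal A ^ (d + 1) := by
  refine Ideal.sum_mem _ fun i hi ↦ ?_
  have hi' : i ≤ d := by simpa [Nat.lt_succ_iff] using hi
  rw [mul_assoc, show d + 1 = 1 + (i + (d - i)) by omega, pow_add, pow_add, pow_one]
  exact Ideal.mul_mem_mul (hc i hi')
    (Ideal.mul_mem_mul (Ideal.pow_mem_pow hx _) (Ideal.pow_mem_pow hy _))

/-- The initial forms of `x` and `y` satisfy a nontrivial homogeneous relation of degree `d` in
the associated graded ring. -/
def HasFormRelation (x y : A) (d : ℕ) : Prop :=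
  ∃ c : ℕ → A, (∃ i ≤ d, IsUnit (c i)) ∧ binaryForm x y d c ∈ maximalIdeal A ^ (d + 1)

/-- Write a ∈ 𝔪^i as a form of degree i. A unit coefficient would make xa ∈ 𝔪^(i+2) a relation of
degree i + 1, so a ∈ 𝔪^(i+1). -/
lemma mem_pow_of_mul_mem_pow {x y : A} (hm : maximalIdeal A = Ideal.span {x, y}) (j : ℕ)
    (hj : ∀ i ≤ j, ¬ HasFormRelation x y i) {a : A} (ha : x * a ∈ maximalIdeal A ^ (j + 1)) :
    a ∈ maximalIdeal A ^ j := by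
  have hx : x ∈ maximalIdeal A := hm ▸ Ideal.subset_span (by simp)
  have hy : y ∈ maximalIdeal A := hm ▸ Ideal.subset_span (by simp)
  suffices h : ∀ i ≤ j, a ∈ maximalIdeal A ^ i from h j le_rfl
  intro i hi
  induction i with
  | zero => simp
  | succ i ih =>
    obtain ⟨c, rfl⟩ := exists_binaryForm_eq i (hm ▸ ih (by omega))
    refine binaryForm_mem_pow_succ hx hy i c fun k hk hu ↦ hj (i + 1) hi ?_
    rw [mul_binaryForm] at ha
    exact ⟨_, ⟨k + 1, by omega, by simpa using hu⟩,
      Ideal.pow_le_pow_right (by omega) ha⟩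

lemma exists_isUnit_eval [Infinite (ResidueField A)] (F : Polynomial A) {i : ℕ}
    (hi : IsUnit (F.coeff i)) : ∃ t, IsUnit (F.eval t) := by
  have hF : F.map (residue A) ≠ 0 := fun h ↦ by
    have := congr_arg (fun p ↦ Polynomial.coeff p i) h
    simp only [Polynomial.coeff_map, Polynomial.coeff_zero] at this
    exact (residue_ne_zero_iff_isUnit _).mpr hi this
  obtain ⟨τ, hτ⟩ : ∃ τ, (F.map (residue A)).eval τ ≠ 0 := by
    by_contra! h
    exact hF (Polynomial.funext fun r ↦ by simp [h r])
  obtain ⟨t, rfl⟩ := residue_surjective τ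
  refine ⟨t, (residue_ne_zero_iff_isUnit _).mp ?_⟩
  rwa [Polynomial.eval_map, Polynomial.eval₂_hom] at hτ

/-- Choose t with F(t) a unit and set z = x - ty. Modulo z𝔪^d the relation becomes F(t)y^(d+1), so
y^(d+1) ∈ z𝔪^d + 𝔪^(d+2), and Nakayama removes the last term. -/
lemma HasFormRelation.exists_pow_succ_eq [IsNoetherianRing A] [Infinite (ResidueField A)] {x y : A}
    (hm : maximalIdeal A = Ideal.span {x, y}) {d : ℕ} (h : HasFormRelation x y (d + 1)) :
    ∃ z, maximalIdeal A = Ideal.span {z, y} ∧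
      maximalIdeal A ^ (d + 1) = Ideal.span {z} * maximalIdeal A ^ d := by
  obtain ⟨c, ⟨i, hi, hci⟩, hc⟩ := h
  let F : Polynomial A := ∑ i ∈ Finset.range (d + 2), Polynomial.monomial i (c i)
  obtain ⟨t, ht⟩ := exists_isUnit_eval F (i := i) (by
    have : i < d + 2 := by omega
    simpa [F, Polynomial.coeff_monomial, this] using hci)
  have hz : maximalIdeal A = Ideal.span {x - t * y, y} := by
    rw [hm]
    refine (Ideal.span_pair_sub_mul_right (x := x) (y := y) t).symm
  refine ⟨x - t * y, hz, le_antisymm ?_ ?_⟩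
  · refine Submodule.le_of_le_smul_of_le_jacobson_bot (I := maximalIdeal A)
      (IsNoetherian.noetherian _) (maximalIdeal_le_jacobson _) ?_
    rw [smul_eq_mul, ← pow_succ']
    have hy : y ^ (d + 1) ∈
        Ideal.span {x - t * y} * maximalIdeal A ^ d ⊔ maximalIdeal A ^ (d + 1 + 1) := by
      rw [← Ideal.unit_mul_mem_iff_mem _ ht]
      have h1 := binaryForm_sub_mem (x := x) (y := y) t d c
      rw [← hm] at h1
      have h2 : F.eval t = ∑ i ∈ Finset.range (d + 2), c i * t ^ i := by
        simp [F, Polynomial.eval_finsetSum]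
      rw [h2]
      have := Ideal.sub_mem _ (Ideal.mem_sup_right hc) (Ideal.mem_sup_left h1)
      rwa [sub_sub_cancel] at this
    have h3 := span_pair_pow_succ_le (x - t * y) y d
    rw [← hz] at h3
    exact h3.trans (sup_le le_sup_left ((Ideal.span_singleton_le_iff_mem _).mpr hy))
  · rw [pow_succ']
    refine Ideal.mul_mono_left ?_
    rw [hz]
    exact Ideal.span_mono (by simp)

/-- If multiplication by `x` maps `𝔪 ^ j` onto `𝔪 ^ (j + 1)`, where `𝔪 = (x, y)`, and the socle is
simple, then the Hilbert function drops by at most one from `j` to `j + 1`. -/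
lemma localHilbertFunction_of_pow_succ_eq [IsArtinianRing A] {x y : A}
    (hm : maximalIdeal A = Ideal.span {x, y})
    (hsoc : ∀ a b : A, (∀ r ∈ maximalIdeal A, r * b = 0) → a ≠ 0 → b ∈ Ideal.span {a})
    (j : ℕ) (h : maximalIdeal A ^ (j + 1) = Ideal.span {x} * maximalIdeal A ^ j) :
    localHilbertFunction A (j + 1) ≤ localHilbertFunction A j ∧
      localHilbertFunction A j ≤ localHilbertFunction A (j + 1) + 1 := by
  set m := maximalIdeal A with hmdef
  have h' : m ^ (j + 2) = Ideal.span {x} * m ^ (j + 1) := by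
    rw [pow_succ', h, mul_left_comm, ← pow_succ', h]
  have hy : y ∈ m := hm ▸ Ideal.subset_span (by simp)
  let φ := LinearMap.mulLeft A x
  let ψ := LinearMap.mulLeft A y
  let P := m ^ j ⊓ LinearMap.ker φ
  let Q := m ^ (j + 1) ⊓ LinearMap.ker φ
  have hP := Module.length_eq_inf_ker_add_map φ (m ^ j)
  have hQ := Module.length_eq_inf_ker_add_map φ (m ^ (j + 1))
  rw [map_mulLeft_eq, ← h] at hP
  rw [map_mulLeft_eq, ← h'] at hQ
  have hPQ := Module.length_eq_inf_ker_add_map ψ P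
  have hψ : Submodule.map ψ P ≤ Q := by
    rintro _ ⟨a, ha, rfl⟩
    refine ⟨?_, ?_⟩
    · rw [pow_succ']
      exact Ideal.mul_mem_mul hy ha.1
    · have hxa : x * a = 0 := ha.2
      show x * (y * a) = 0
      rw [mul_left_comm, hxa, mul_zero]
  have hker : Module.length A ↥(P ⊓ LinearMap.ker ψ) ≤ 1 := by
    refine Module.length_le_one_of_socle hsoc _ fun r hr a ha ↦ ?_
    have hxa : x * a = 0 := ha.1.2
    have hya : y * a = 0 := ha.2
    rw [← hmdef, hm] at hr
    obtain ⟨u, v, rfl⟩ := Ideal.mem_span_pair.mp hr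
    rw [add_mul, mul_assoc, mul_assoc, hxa, hya, mul_zero, mul_zero, add_zero]
  have hle1 : Module.length A Q ≤ Module.length A P :=
    Module.length_submodule_le (inf_le_inf_right _ (Ideal.pow_le_pow_right (by omega)))
  have hle2 : Module.length A P ≤ Module.length A Q + 1 := by
    rw [hPQ, add_comm]
    exact add_le_add (Module.length_submodule_le hψ) hker
  have e0 := localHilbertFunction_add_length (A := A) j
  have e1 := localHilbertFunction_add_length (A := A) (j + 1)
  have f1 : Module.length A ↥(m ^ (j + 1)) ≠ ⊤ := Module.length_ne_top
  have f2 : Module.length A ↥(m ^ (j + 2)) ≠ ⊤ := Module.length_ne_top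
  -- The image x𝔪^j is 𝔪^(j+1), whose finite length cancels, leaving the kernel.
  have g0 : (localHilbertFunction A j : ℕ∞) = Module.length A P :=
    WithTop.add_right_cancel f1 (e0.trans hP)
  have g1 : (localHilbertFunction A (j + 1) : ℕ∞) = Module.length A Q :=
    WithTop.add_right_cancel f2 (e1.trans hQ)
  rw [← g0, ← g1] at hle1 hle2
  exact ⟨by exact_mod_cast hle1, by exact_mod_cast hle2⟩

/-- If multiplication by `x` induces an injection `𝔪 ^ j / 𝔪 ^ (j + 1) → 𝔪 ^ (j + 1) / 𝔪 ^ (j + 2)`,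
where `𝔪 = (x, y)`, then the Hilbert function grows by at most one from `j` to `j + 1`. -/
lemma localHilbertFunction_of_mul_mem_pow [IsArtinianRing A] {x y : A}
    (hm : maximalIdeal A = Ideal.span {x, y}) (j : ℕ)
    (h : ∀ a, x * a ∈ maximalIdeal A ^ (j + 2) → a ∈ maximalIdeal A ^ (j + 1)) :
    localHilbertFunction A j ≤ localHilbertFunction A (j + 1) ∧
      localHilbertFunction A (j + 1) ≤ localHilbertFunction A j + 1 := by
  set m := maximalIdeal A
  have hx : x ∈ m := hm ▸ Ideal.subset_span (by simp)
  have hy : y ∈ m := hm ▸ Ideal.subset_span (by simp)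
  -- N ≤ S ≤ 𝔪^(j+1), where S/N is the image of x and has length h_j.
  let N := m ^ (j + 2)
  let S := Ideal.span {x} * m ^ j ⊔ N
  let φ := N.mkQ ∘ₗ LinearMap.mulLeft A x
  have hS := Module.length_eq_inf_ker_add_map N.mkQ S
  have hJ := Module.length_eq_inf_ker_add_map φ (m ^ j)
  have hker : m ^ j ⊓ LinearMap.ker φ = m ^ (j + 1) := by
    ext a
    have hφ : a ∈ LinearMap.ker φ ↔ x * a ∈ N := by
      simp only [φ, LinearMap.mem_ker, LinearMap.comp_apply, LinearMap.mulLeft_apply,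
        Submodule.mkQ_apply, Submodule.Quotient.mk_eq_zero]
    rw [Submodule.mem_inf, hφ]
    refine ⟨fun ha ↦ h a ha.2, fun ha ↦ ⟨Ideal.pow_le_pow_right (by omega) ha, ?_⟩⟩
    show x * a ∈ m ^ (j + 1 + 1)
    rw [pow_succ']
    exact Ideal.mul_mem_mul hx ha
  have hmap : Submodule.map N.mkQ S = Submodule.map φ (m ^ j) := by
    rw [Submodule.map_sup, Submodule.mkQ_map_self, sup_bot_eq, Submodule.map_comp,
      map_mulLeft_eq]
  rw [Submodule.ker_mkQ, inf_eq_right.mpr (le_sup_right : N ≤ S), hmap] at hS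
  rw [hker] at hJ
  have hle1 : Module.length A S ≤ Module.length A ↥(m ^ (j + 1)) := by
    refine Module.length_submodule_le (sup_le ?_ (Ideal.pow_le_pow_right (by omega)))
    rw [pow_succ']
    exact Ideal.mul_mono_left ((Ideal.span_singleton_le_iff_mem _).mpr hx)
  have hle2 : Module.length A ↥(m ^ (j + 1)) ≤ Module.length A S + 1 := by
    refine Module.length_le_add_one_of_le_sup_span (y ^ (j + 1)) (fun r hr ↦ ?_) ?_
    · refine Ideal.mem_sup_right ?_
      show r * y ^ (j + 1) ∈ m ^ (j + 1 + 1)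
      rw [pow_succ']
      exact Ideal.mul_mem_mul hr (Ideal.pow_mem_pow hy _)
    · have h3 := span_pair_pow_succ_le x y j
      rw [← hm] at h3
      exact h3.trans (sup_le_sup_right le_sup_left _)
  have e0 := localHilbertFunction_add_length (A := A) j
  have e1 := localHilbertFunction_add_length (A := A) (j + 1)
  have f1 : Module.length A ↥(m ^ (j + 1)) ≠ ⊤ := Module.length_ne_top
  have f2 : Module.length A N ≠ ⊤ := Module.length_ne_top
  have g0 : (localHilbertFunction A j : ℕ∞) = Module.length A ↥(Submodule.map φ (m ^ j)) :=
    WithTop.add_right_cancel f1 ((e0.trans hJ).trans (add_comm _ _))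
  rw [← g0, add_comm] at hS
  rw [hS, ← e1] at hle1 hle2
  rw [add_right_comm (localHilbertFunction A j : ℕ∞)] at hle2
  have k1 : (localHilbertFunction A j : ℕ∞) ≤ localHilbertFunction A (j + 1) :=
    WithTop.le_of_add_le_add_right f2 hle1
  have k2 : (localHilbertFunction A (j + 1) : ℕ∞) ≤ localHilbertFunction A j + 1 :=
    WithTop.le_of_add_le_add_right f2 hle2
  exact ⟨by exact_mod_cast k1, by exact_mod_cast k2⟩

/-- The Hilbert function of an Artinian local ring of embedding dimension at most two, with
infinite residue field and simple socle, changes by at most one at each step. -/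
lemma abs_localHilbertFunction_sub_le_one [IsArtinianRing A] [Infinite (ResidueField A)] {x y : A}
    (hm : maximalIdeal A = Ideal.span {x, y})
    (hsoc : ∀ a b : A, (∀ r ∈ maximalIdeal A, r * b = 0) → a ≠ 0 → b ∈ Ideal.span {a})
    (j : ℕ) :
    |(localHilbertFunction A (j + 1) : ℤ) - (localHilbertFunction A j : ℤ)| ≤ 1 := by
  rw [abs_le]
  by_cases h : ∀ i ≤ j + 1, ¬ HasFormRelation x y i
  · have := localHilbertFunction_of_mul_mem_pow hm j fun a ↦ mem_pow_of_mul_mem_pow hm (j + 1) h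
    omega
  · push Not at h
    obtain ⟨i, hi, hrel⟩ := h
    cases i with
    | zero =>
      -- A relation of degree 0 would put a unit in 𝔪.
      obtain ⟨c, ⟨i, hi, hu⟩, hc⟩ := hrel
      obtain rfl : i = 0 := by omega
      exact absurd hu (by simpa [binaryForm] using hc)
    | succ d =>
      obtain ⟨z, hz, hzd⟩ := hrel.exists_pow_succ_eq hm
      have hzj : maximalIdeal A ^ (j + 1) = Ideal.span {z} * maximalIdeal A ^ j := by
        obtain ⟨k, rfl⟩ : ∃ k, j = d + k := ⟨j - d, by omega⟩
        rw [add_right_comm, pow_add, hzd, mul_assoc, ← pow_add]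
      have := localHilbertFunction_of_pow_succ_eq hz hsoc j hzj
      omega

end HilbertFunction

/-! ### Passage from R to R/I. -/

lemma IsRegularLocalRing.exists_maximalIdeal_eq_span_pair {R : Type*} [CommRing R]
    [IsRegularLocalRing R] (hdim : ringKrullDim R = 2) :
    ∃ x y : R, maximalIdeal R = Ideal.span {x, y} := by
  have h : (maximalIdeal R).spanFinrank = 2 := by
    have := IsRegularLocalRing.spanFinrank_maximalIdeal (R := R)
    rw [hdim] at this
    exact_mod_cast this
  rw [← Submodule.FG.generators_ncard (maximalIdeal R).fg_of_isNoetherianRing,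
    Set.ncard_eq_two] at h
  obtain ⟨x, y, -, hxy⟩ := h
  exact ⟨x, y, by rw [← hxy]; exact (Submodule.span_generators _).symm⟩

theorem mainTheorem3 {R : Type*} [CommRing R] [IsRegularLocalRing R]
    (hdim : ringKrullDim R = 2) (hk : Infinite (ResidueField R))
    (I : Ideal R) [IsArtinianRing (R ⧸ I)] [IsGorensteinLocalRing (R ⧸ I)]
    (j : ℕ) (hj : 0 < j) :
    |(localHilbertFunction (R ⧸ I) j : ℤ) - (localHilbertFunction (R ⧸ I) (j - 1) : ℤ)| ≤ 1 := by
  have hsurj : Function.Surjective (Ideal.Quotient.mk I) := Ideal.Quotient.mk_surjective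
  have hloc : IsLocalHom (Ideal.Quotient.mk I) := .of_surjective _ hsurj
  have hinf : Infinite (ResidueField (R ⧸ I)) :=
    Infinite.of_injective _ (ResidueField.map (Ideal.Quotient.mk I)).injective
  obtain ⟨x, y, hxy⟩ := IsRegularLocalRing.exists_maximalIdeal_eq_span_pair hdim
  have hm : maximalIdeal (R ⧸ I) = Ideal.span {Ideal.Quotient.mk I x, Ideal.Quotient.mk I y} := by
    rw [← map_maximalIdeal_of_surjective _ hsurj, hxy, Ideal.map_span, Set.image_pair]
  obtain ⟨j, rfl⟩ := Nat.exists_eq_add_of_lt hj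
  rw [zero_add, Nat.add_sub_cancel]
  exact abs_localHilbertFunction_sub_le_one hm
    (fun _ _ ↦ IsGorensteinLocalRing.mem_span_singleton_of_socle) j
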